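/- Let $F$ be a finite field, let $\sigma$ be an automorphism of $F$ of order $\mu$, and let $R=F[X;\sigma]$ be the skew polynomial ring, whose elements are the left polynomials $\sum_i a_iX^i$ with $a_i\in F$, multiplied by the rule $Xa=\sigma(a)X$ for $a\in F$. Let $F^\sigma=\{a\in F:\sigma(a)=a\}$ and $z=X^\mu$; the commutative polynomial ring $F^\sigma[z]$ is regarded as a subring of $R$. A polynomial $f\in R$ is called irreducible if it has positive degree and, whenever $f=gh$ with $g,h\in R$, then $g\in F$ or $h\in F$. A bound of $f\in R$ is an element $f^*\in R$ such that $Rf^*=f^*R$ and this is the largest two-sided ideal of $R$ contained in $Rf$; a bound is determined up to multiplication by nonzero elements of $F$. Let $f\in R$ be such that $1$ is a right greatest common divisor of $f$ and $X$. Then $f$ has a bound $f^*$ lying in $F^\sigma[z]$, and for every such choice of $f^*\in F^\sigma[z]$: $f$ is irreducible in $R$ if and only if $f^*$ is irreducible in the commutative polynomial ring $F^\sigma[z]$ and $\deg f^*=\mu\deg f$, where both degrees are degrees in $X$, taken in $R$. -/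

import Mathlib

/-- A copy of the field `F`, carrying the action of `ℕ` (written multiplicatively) in which `n`
acts as `σ ^ n`. Mathlib's skew polynomials read off the twist `X * a = σ a * X` from such an
action, so that `SkewPolynomial (Twist σ)` is `F[X; σ]`. -/
def Twist {F : Type*} [Field F] (_σ : F ≃+* F) : Type _ := F

namespace Twist

instance instField {F : Type*} [Field F] (σ : F ≃+* F) : Field (Twist σ) :=
  inferInstanceAs (Field F)

/-- The identity map, from `F` to its copy. -/
def of {F : Type*} [Field F] (σ : F ≃+* F) : F ≃+* Twist σ := RingEquiv.refl F

/-- The natural number `n` acts on `F` as `σ ^ n`. -/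
instance instMulSemiringAction {F : Type*} [Field F] (σ : F ≃+* F) :
    MulSemiringAction (Multiplicative ℕ) (Twist σ) where
  smul n a := of σ ((σ ^ Multiplicative.toAdd n) ((of σ).symm a))
  one_smul _ := rfl
  mul_smul m n a := by
    change of σ ((σ ^ (Multiplicative.toAdd m + Multiplicative.toAdd n)) ((of σ).symm a)) = _
    rw [pow_add]
    rfl
  smul_zero n := map_zero (σ ^ Multiplicative.toAdd n)
  smul_add n := map_add (σ ^ Multiplicative.toAdd n)
  smul_one n := map_one (σ ^ Multiplicative.toAdd n)
  smul_mul n := map_mul (σ ^ Multiplicative.toAdd n)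

end Twist

/-- The skew polynomial ring `F[X; σ]`: left polynomials `∑ aᵢ Xⁱ` with `X * a = σ a * X`. -/
abbrev OrePoly {F : Type*} [Field F] (σ : F ≃+* F) : Type _ := SkewPolynomial (Twist σ)

namespace OrePoly

/-- The embedding of `F` in `F[X; σ]` as the constant polynomials. -/
noncomputable def const {F : Type*} [Field F] (σ : F ≃+* F) : F →+* OrePoly σ :=
  SkewPolynomial.CRingHom.comp (Twist.of σ : F →+* Twist σ)

/-- The variable of `F[X; σ]`. -/
noncomputable def var {F : Type*} [Field F] (σ : F ≃+* F) : OrePoly σ := SkewPolynomial.X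

/-- The commutation rule of the skew polynomial ring. -/
theorem var_mul_const {F : Type*} [Field F] (σ : F ≃+* F) (a : F) :
    var σ * const σ a = const σ (σ a) * var σ := by
  change SkewPolynomial.X * SkewPolynomial.monomial 0 (Twist.of σ a) =
    SkewPolynomial.monomial 0 (Twist.of σ (σ a)) * SkewPolynomial.X
  rw [SkewPolynomial.X_mul_monomial, SkewPolynomial.monomial_mul_X]
  rfl

/-- The degree, with `deg 0 = ⊥`. -/
def degree {F : Type*} [Field F] {σ : F ≃+* F} (f : OrePoly σ) : WithBot ℕ :=
  (SkewPolynomial.support f).max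

/-- Irreducibility of a skew polynomial: it has positive degree and in each factorization into two
factors one of the factors is a constant. -/
def IsIrred {F : Type*} [Field F] {σ : F ≃+* F} (f : OrePoly σ) : Prop :=
  0 < degree f ∧ ∀ g h : OrePoly σ, f = g * h → g ∈ (const σ).range ∨ h ∈ (const σ).range

/-- The invariant subfield `F^σ = {a ∈ F | σ a = a}`. -/
def fixedField {F : Type*} [Field F] (σ : F ≃+* F) : Subfield F :=
  (σ : F →+* F).eqLocusField (RingHom.id F)

/-- The element `p(X^μ)` of `F[X; σ]`, where `μ` is the order of `σ` and `p ∈ F^σ[z]`. -/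
noncomputable def evalZ {F : Type*} [Field F] (σ : F ≃+* F)
    (p : Polynomial (fixedField σ)) : OrePoly σ :=
  p.eval₂ ((const σ).comp (fixedField σ).subtype) (var σ ^ orderOf (σ : RingAut F))

end OrePoly

/-- `d` is a right greatest common divisor of `f` and `g`
(`e ∣ᵣ f` means `f = a * e` for some `a`). -/
def IsRightGCD {R : Type*} [Ring R] (f g d : R) : Prop :=
  d ∣ᵣ f ∧ d ∣ᵣ g ∧ ∀ e : R, e ∣ᵣ f → e ∣ᵣ g → e ∣ᵣ d

/-- `b` is a bound of `f`: `Rb = bR` is the largest twosided ideal contained in `Rf`.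
(Mathlib's `Ideal` means left ideal, and `Ideal.span {f}` is `Rf`.) -/
structure IsBound {R : Type*} [Ring R] (f b : R) : Prop where
  twoSided : ∀ x : R, x ∈ Ideal.span {b} ↔ ∃ c : R, x = b * c
  le : Ideal.span {b} ≤ Ideal.span {f}
  greatest : ∀ I : Ideal R, I.IsTwoSided → I ≤ Ideal.span {f} → I ≤ Ideal.span {b}

/-! Put `M = R/Rf`. A two-sided ideal lies in `Rf` exactly when it annihilates `M`, so bounds of `f`
generate `Ann M` (`isBound_evalZ_iff`). Division with remainder makes `M` finite, while `F^σ[z]` is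
central and infinite, so `Ann M ≠ 0`. Coprimality with `X` means a nonzero constant term; then `X`
may be cancelled in `Ann M`, and a monic generator of least degree must be central, hence in
`F^σ[z]` (`exists_span_evalZ_eq`).

If `f` is irreducible, `M` is a finite simple module and `D = End M` is a finite field by Schur and
Wedderburn. By density, `F^σ[z] → D` is onto (`evalZEnd_surjective`) with kernel `(p)`, so `p` is
irreducible. Density also gives `|M| = |D|^e` and `|R/Ann M| = |D|^(e^2)`; counting both over `F^σ`
forces `e = μ` and `deg_z p = deg f` (`IsIrred.irreducible_bound`).

Conversely, the bound of an irreducible right factor `h` of `f` divides `p`, hence is associated to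
it, and the degree formula for `h` gives `deg h = deg f`. -/

namespace OrePoly

variable {F : Type*} [Field F] {σ : F ≃+* F}

/-! ### Coefficients, degrees and commutators -/

/-- The coefficient of `X ^ n`. -/
def coeff (f : OrePoly σ) (n : ℕ) : F := (Twist.of σ).symm (SkewPolynomial.coeff f n)

/-- The skew polynomial `a * X ^ n`. -/
noncomputable def monomial (σ : F ≃+* F) (n : ℕ) (a : F) : OrePoly σ :=
  SkewPolynomial.monomial n (Twist.of σ a)

theorem ext_coeff {f g : OrePoly σ} (h : ∀ n, coeff f n = coeff g n) : f = g :=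
  SkewPolynomial.ext h

theorem coeff_zero (n : ℕ) : coeff (0 : OrePoly σ) n = 0 := rfl

theorem coeff_add (f g : OrePoly σ) (n : ℕ) : coeff (f + g) n = coeff f n + coeff g n :=
  SkewPolynomial.coeff_add f g n

theorem coeff_sub (f g : OrePoly σ) (n : ℕ) : coeff (f - g) n = coeff f n - coeff g n :=
  SkewPolynomial.coeff_sub f g n

theorem coeff_monomial (n : ℕ) (a : F) (m : ℕ) :
    coeff (monomial σ n a) m = if n = m then a else 0 :=
  SkewPolynomial.coeff_monomial

theorem monomial_mul_monomial (m n : ℕ) (a b : F) :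
    monomial σ m a * monomial σ n b = monomial σ (m + n) (a * (σ ^ m) b) := by
  refine (SkewPolynomial.monomial_mul_monomial m n _ _).trans ?_
  rw [SkewPolynomial.φ_iterate_apply]
  rfl

theorem monomial_zero_one : monomial σ 0 1 = 1 := rfl

theorem const_eq_monomial (a : F) : const σ a = monomial σ 0 a := rfl

theorem var_eq_monomial : var σ = monomial σ 1 1 := rfl

theorem var_pow_eq_monomial (n : ℕ) : var σ ^ n = monomial σ n 1 :=
  SkewPolynomial.X_pow_eq_monomial n

theorem induction {motive : OrePoly σ → Prop} (f : OrePoly σ) (zero : motive 0)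
    (monomial_add : ∀ (n : ℕ) (a : F) (g : OrePoly σ), motive g → motive (monomial σ n a + g)) :
    motive f :=
  SkewPolynomial.induction f zero fun n a g _ _ hg => monomial_add n a g hg

theorem coeff_monomial_mul (m : ℕ) (a : F) (g : OrePoly σ) (k : ℕ) :
    coeff (monomial σ m a * g) k = if m ≤ k then a * (σ ^ m) (coeff g (k - m)) else 0 := by
  induction g using induction with
  | zero => simp [coeff_zero]
  | monomial_add n b g ih =>
    rw [mul_add, coeff_add, ih, monomial_mul_monomial, coeff_monomial, coeff_add, coeff_monomial]
    by_cases h : m ≤ k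
    · rw [if_pos h, if_pos h]
      by_cases h' : m + n = k
      · rw [if_pos h', if_pos (by omega), map_add, mul_add]
      · rw [if_neg h', if_neg (by omega), map_add, map_zero, zero_add, zero_add]
    · rw [if_neg h, if_neg h, if_neg (by omega), add_zero]

theorem coeff_mul_monomial (f : OrePoly σ) (n : ℕ) (b : F) (k : ℕ) :
    coeff (f * monomial σ n b) k =
      if n ≤ k then coeff f (k - n) * (σ ^ (k - n)) b else 0 := by
  induction f using induction with
  | zero => simp [coeff_zero]
  | monomial_add m a f ih =>
    rw [add_mul, coeff_add, ih, monomial_mul_monomial, coeff_monomial, coeff_add, coeff_monomial]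
    by_cases h : n ≤ k
    · rw [if_pos h, if_pos h]
      by_cases h' : m + n = k
      · have : k - n = m := by omega
        rw [if_pos h', if_pos this.symm, this, add_mul]
      · rw [if_neg h', if_neg (by omega), zero_add, zero_add]
    · rw [if_neg h, if_neg h, if_neg (by omega), add_zero]

theorem coeff_const_mul (a : F) (f : OrePoly σ) (k : ℕ) :
    coeff (const σ a * f) k = a * coeff f k := by
  rw [const_eq_monomial, coeff_monomial_mul, if_pos (Nat.zero_le k)]
  rfl

theorem coeff_mul (f g : OrePoly σ) (k : ℕ) :
    coeff (f * g) k = ∑ i ∈ Finset.range (k + 1), coeff f i * (σ ^ i) (coeff g (k - i)) := by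
  induction f using induction with
  | zero => simp [coeff_zero]
  | monomial_add m a f ih =>
    simp only [add_mul, coeff_add, ih, Finset.sum_add_distrib, coeff_monomial_mul, coeff_monomial,
      ite_mul, zero_mul, Finset.sum_ite_eq, Finset.mem_range, Nat.lt_succ_iff]

/-- `f` has degree less than `n`. -/
def DegLT (f : OrePoly σ) (n : ℕ) : Prop := ∀ m, n ≤ m → coeff f m = 0

/-- `f` has degree exactly `n`. -/
def HasDeg (f : OrePoly σ) (n : ℕ) : Prop := coeff f n ≠ 0 ∧ DegLT f (n + 1)

theorem mem_support {f : OrePoly σ} {n : ℕ} :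
    n ∈ SkewPolynomial.support f ↔ coeff f n ≠ 0 :=
  SkewPolynomial.mem_support_iff

theorem exists_degLT (f : OrePoly σ) : ∃ n, DegLT f n := by
  refine ⟨(SkewPolynomial.support f).sup id + 1, fun m hm => ?_⟩
  by_contra h
  have := Finset.le_sup (f := id) (mem_support.mpr h)
  simp only [id] at this
  omega

theorem DegLT.mono {f : OrePoly σ} {m n : ℕ} (h : DegLT f m) (hmn : m ≤ n) : DegLT f n :=
  fun k hk => h k (hmn.trans hk)

theorem DegLT.add {f g : OrePoly σ} {n : ℕ} (hf : DegLT f n) (hg : DegLT g n) :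
    DegLT (f + g) n := fun k hk => by rw [coeff_add, hf k hk, hg k hk, add_zero]

theorem DegLT.sub {f g : OrePoly σ} {n : ℕ} (hf : DegLT f n) (hg : DegLT g n) :
    DegLT (f - g) n := fun k hk => by rw [coeff_sub, hf k hk, hg k hk, sub_zero]

theorem degLT_zero {f : OrePoly σ} : DegLT f 0 ↔ f = 0 :=
  ⟨fun h => ext_coeff fun n => h n (Nat.zero_le n), fun h => h ▸ fun _ _ => rfl⟩

theorem degLT_monomial (n : ℕ) (a : F) : DegLT (monomial σ n a) (n + 1) := fun m hm => by
  rw [coeff_monomial, if_neg (by omega)]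

theorem DegLT.of_succ {f : OrePoly σ} {n : ℕ} (h : DegLT f (n + 1)) (h0 : coeff f n = 0) :
    DegLT f n := fun m hm => by
  rcases hm.eq_or_lt with rfl | hm
  exacts [h0, h m hm]

theorem exists_hasDeg {f : OrePoly σ} (hf : f ≠ 0) : ∃ n, HasDeg f n := by
  classical
  have hex := exists_degLT f
  obtain ⟨n, hn⟩ : ∃ n, Nat.find hex = n + 1 := Nat.exists_eq_succ_of_ne_zero fun h => by
    have := Nat.find_spec hex
    rw [h] at this
    exact hf (degLT_zero.mp this)
  have h1 := Nat.find_spec hex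
  rw [hn] at h1
  exact ⟨n, fun h0 => Nat.find_min hex (m := n) (by omega) (h1.of_succ h0), h1⟩

theorem HasDeg.ne_zero {f : OrePoly σ} {n : ℕ} (h : HasDeg f n) : f ≠ 0 := by
  rintro rfl
  exact h.1 rfl

theorem HasDeg.lt_of_degLT {f : OrePoly σ} {m n : ℕ} (h : HasDeg f n) (h' : DegLT f m) :
    n < m := by
  by_contra hn
  exact h.1 (h' n (by omega))

theorem HasDeg.unique {f : OrePoly σ} {m n : ℕ} (h : HasDeg f n) (h' : HasDeg f m) : n = m := by
  have := h.lt_of_degLT h'.2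
  have := h'.lt_of_degLT h.2
  omega

theorem HasDeg.degree_eq {f : OrePoly σ} {n : ℕ} (h : HasDeg f n) : degree f = n := by
  refine le_antisymm (Finset.max_le fun m hm => ?_) (Finset.le_max (mem_support.mpr h.1))
  by_contra hmn
  exact mem_support.mp hm (h.2 m (WithBot.coe_lt_coe.mp (not_le.mp hmn)))

theorem HasDeg.mul {f g : OrePoly σ} {m n : ℕ} (hf : HasDeg f m) (hg : HasDeg g n) :
    HasDeg (f * g) (m + n) := by
  constructor
  · rw [coeff_mul, Finset.sum_eq_single m]
    · rw [Nat.add_sub_cancel_left]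
      exact mul_ne_zero hf.1 ((map_ne_zero_iff _ (σ ^ m).injective).mpr hg.1)
    · intro i hi him
      rcases lt_or_gt_of_ne him with h | h
      · rw [hg.2 _ (by omega), map_zero, mul_zero]
      · rw [hf.2 _ (by omega), zero_mul]
    · intro h
      simp at h
  · intro k hk
    rw [coeff_mul]
    refine Finset.sum_eq_zero fun i hi => ?_
    rcases lt_or_ge m i with h | h
    · rw [hf.2 _ (by omega), zero_mul]
    · rw [hg.2 _ (by omega), map_zero, mul_zero]

theorem coeff_mul_zero (f g : OrePoly σ) : coeff (f * g) 0 = coeff f 0 * coeff g 0 := by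
  rw [coeff_mul]
  simp

/-- Commutators with the variable. -/
theorem coeff_var_mul_sub_mul_var (f : OrePoly σ) (k : ℕ) :
    coeff (var σ * f - f * var σ) (k + 1) = σ (coeff f k) - coeff f k := by
  rw [coeff_sub, var_eq_monomial, coeff_monomial_mul, coeff_mul_monomial,
    if_pos (Nat.le_add_left 1 k), if_pos (Nat.le_add_left 1 k), Nat.add_sub_cancel, map_one,
    mul_one, one_mul, pow_one]

theorem coeff_var_mul_sub_mul_var_zero (f : OrePoly σ) :
    coeff (var σ * f - f * var σ) 0 = 0 := by
  rw [coeff_sub, coeff_mul_zero, coeff_mul_zero, mul_comm, sub_self]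

theorem coeff_mul_const_sub_const_mul (f : OrePoly σ) (a b : F) (k : ℕ) :
    coeff (f * const σ a - const σ b * f) k = coeff f k * ((σ ^ k) a - b) := by
  rw [coeff_sub, coeff_const_mul, const_eq_monomial, coeff_mul_monomial, if_pos (Nat.zero_le k),
    Nat.sub_zero]
  ring

theorem mem_range_const {f : OrePoly σ} : f ∈ (const σ).range ↔ DegLT f 1 := by
  constructor
  · rintro ⟨a, rfl⟩
    exact degLT_monomial 0 a
  · intro h
    refine ⟨coeff f 0, ext_coeff fun n => ?_⟩
    rw [const_eq_monomial, coeff_monomial]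
    split_ifs with hn
    · rw [hn]
    · exact (h n (by omega)).symm

theorem hasDeg_const {a : F} (ha : a ≠ 0) : HasDeg (const σ a) 0 := by
  refine ⟨?_, degLT_monomial 0 a⟩
  rwa [const_eq_monomial, coeff_monomial, if_pos rfl]

/-! ### Right division, left ideals and finite quotients -/

/-- Division with remainder by `f` on the right. -/
theorem exists_eq_mul_add {f : OrePoly σ} {n : ℕ} (hf : HasDeg f n) (g : OrePoly σ) :
    ∃ q r : OrePoly σ, g = q * f + r ∧ DegLT r n := by
  obtain ⟨k, hk⟩ := exists_degLT g
  induction k generalizing g with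
  | zero => exact ⟨0, g, by simp, hk.mono (Nat.zero_le n)⟩
  | succ k ih =>
    rcases lt_or_ge k n with h | h
    · exact ⟨0, g, by simp, hk.mono h⟩
    have hne : (σ ^ (k - n)) (coeff f n) ≠ 0 :=
      (map_ne_zero_iff _ (σ ^ (k - n)).injective).mpr hf.1
    -- The divisor is twisted because `X ^ (k - n)` moves past the leading coefficient of `f`; `t *
    -- f` then cancels the top term of `g`.
    set t := monomial σ (k - n) (coeff g k / (σ ^ (k - n)) (coeff f n)) with ht
    have hlt : DegLT (g - t * f) k := by
      refine DegLT.of_succ (hk.sub fun m hm => ?_) ?_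
      · rw [ht, coeff_monomial_mul]
        split_ifs
        · rw [hf.2 (m - (k - n)) (by omega), map_zero, mul_zero]
        · rfl
      · rw [coeff_sub, ht, coeff_monomial_mul, if_pos (by omega), show k - (k - n) = n by omega,
          div_mul_cancel₀ _ hne, sub_self]
    obtain ⟨q, r, hqr, hr⟩ := ih _ hlt
    exact ⟨t + q, r, by rw [add_mul, add_assoc, ← hqr, add_sub_cancel], hr⟩

theorem eq_zero_of_mem_span {f x : OrePoly σ} {n : ℕ} (hf : HasDeg f n)
    (hx : x ∈ Ideal.span {f}) (hxn : DegLT x n) : x = 0 := by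
  obtain ⟨c, rfl⟩ := Ideal.mem_span_singleton'.mp hx
  by_contra h0
  obtain ⟨m, hm⟩ := exists_hasDeg (f := c) (by rintro rfl; exact h0 (zero_mul f))
  have := (hm.mul hf).lt_of_degLT hxn
  omega

/-- Compared with `eq_zero_of_mem_span`, degree `n` itself is allowed: such a multiple is a constant
times `f`, and the constant term detects the constant. -/
theorem eq_zero_of_mem_span_of_coeff_zero {f x : OrePoly σ} {n : ℕ} (hf : HasDeg f n)
    (hf0 : coeff f 0 ≠ 0) (hx : x ∈ Ideal.span {f}) (hxn : DegLT x (n + 1))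
    (hx0 : coeff x 0 = 0) : x = 0 := by
  obtain ⟨c, rfl⟩ := Ideal.mem_span_singleton'.mp hx
  by_contra h0
  obtain ⟨m, hm⟩ := exists_hasDeg (f := c) (by rintro rfl; exact h0 (zero_mul f))
  have := (hm.mul hf).lt_of_degLT hxn
  obtain rfl : m = 0 := by omega
  rw [coeff_mul_zero] at hx0
  exact (mul_ne_zero hm.1 hf0) hx0

/-- Left ideals are principal. -/
theorem exists_eq_span (I : Ideal (OrePoly σ)) : ∃ g, I = Ideal.span {g} := by
  classical
  by_cases hI : I = ⊥
  · exact ⟨0, by simp [hI]⟩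
  have hex : ∃ n, ∃ g ∈ I, HasDeg g n := by
    obtain ⟨g, hg, hg0⟩ := Submodule.exists_mem_ne_zero_of_ne_bot hI
    obtain ⟨n, hn⟩ := exists_hasDeg hg0
    exact ⟨n, g, hg, hn⟩
  obtain ⟨g, hg, hn⟩ := Nat.find_spec hex
  refine ⟨g, le_antisymm (fun x hx => ?_) ((Ideal.span_singleton_le_iff_mem I).mpr hg)⟩
  obtain ⟨q, r, rfl, hr⟩ := exists_eq_mul_add hn x
  have hrI : r ∈ I := (Submodule.add_mem_iff_right I (I.mul_mem_left q hg)).mp hx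
  have hr0 : r = 0 := by
    by_contra h
    obtain ⟨m, hm⟩ := exists_hasDeg h
    exact Nat.find_min hex (hm.lt_of_degLT hr) ⟨r, hrI, hm⟩
  rw [hr0, add_zero]
  exact Ideal.mul_mem_left _ q (Ideal.mem_span_singleton_self g)

theorem hasDeg_var : HasDeg (var σ) 1 :=
  ⟨by simp [var_eq_monomial, coeff_monomial], degLT_monomial 1 1⟩

theorem exists_eq_mul_var {f : OrePoly σ} (hf : coeff f 0 = 0) : ∃ g, f = g * var σ := by
  obtain ⟨q, r, hqr, hr⟩ := exists_eq_mul_add hasDeg_var f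
  have : r = 0 := by
    refine degLT_zero.mp (hr.of_succ ?_)
    rw [hqr, coeff_add, coeff_mul_zero] at hf
    simpa [var_eq_monomial, coeff_monomial] using hf
  exact ⟨q, by rw [hqr, this, add_zero]⟩

theorem exists_mul_var_eq (f : OrePoly σ) : ∃ g, f * var σ = var σ * g := by
  induction f using induction with
  | zero => exact ⟨0, by simp⟩
  | monomial_add n a f ih =>
    obtain ⟨g, hg⟩ := ih
    refine ⟨monomial σ n (σ.symm a) + g, ?_⟩
    rw [add_mul, mul_add, hg, var_eq_monomial, monomial_mul_monomial, monomial_mul_monomial,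
      add_comm 1 n]
    simp

/-- Without a constant term, `X` would be a common right divisor and hence would divide `1`. -/
theorem coeff_zero_ne_zero_of_isRightGCD {f : OrePoly σ} (hf : IsRightGCD f (var σ) 1) :
    coeff f 0 ≠ 0 := by
  intro h0
  obtain ⟨g, hg⟩ := exists_eq_mul_var h0
  obtain ⟨c, hc⟩ := hf.2.2 (var σ) ⟨g, hg⟩ ⟨1, (one_mul _).symm⟩
  have := congrArg (coeff · 0) hc
  simp only [coeff_mul_zero] at this
  simp [var_eq_monomial, coeff_monomial, ← monomial_zero_one] at this

/-- Skew polynomials of degree less than `n` correspond to `n`-tuples of coefficients. -/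
theorem exists_degLT_coeff_eq (n : ℕ) (a : ℕ → F) :
    ∃ f : OrePoly σ, DegLT f n ∧ ∀ i < n, coeff f i = a i := by
  induction n with
  | zero => exact ⟨0, fun _ _ => rfl, by simp⟩
  | succ n ih =>
    obtain ⟨f, hf, hfa⟩ := ih
    refine ⟨f + monomial σ n (a n), (hf.mono n.le_succ).add (degLT_monomial n _), fun i hi => ?_⟩
    rw [coeff_add, coeff_monomial]
    split_ifs with h
    · rw [← h, hf n le_rfl, zero_add]
    · rw [hfa i (by omega), add_zero]

theorem card_quotient_span {f : OrePoly σ} {n : ℕ} (hf : HasDeg f n) :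
    Nat.card (OrePoly σ ⧸ Ideal.span {f}) = Nat.card F ^ n := by
  let e : {r : OrePoly σ // DegLT r n} → OrePoly σ ⧸ Ideal.span {f} :=
    fun r => Submodule.Quotient.mk r.1
  have he : Function.Bijective e := by
    constructor
    · intro r s hrs
      exact Subtype.ext (sub_eq_zero.mp
        (eq_zero_of_mem_span hf ((Submodule.Quotient.eq _).mp hrs) (r.2.sub s.2)))
    · intro x
      obtain ⟨g, rfl⟩ := Submodule.Quotient.mk_surjective _ x
      obtain ⟨q, r, rfl, hr⟩ := exists_eq_mul_add hf g
      refine ⟨⟨r, hr⟩, ((Submodule.Quotient.eq _).mpr ?_).symm⟩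
      rw [add_sub_cancel_right]
      exact Ideal.mul_mem_left _ q (Ideal.mem_span_singleton_self f)
  let c : {r : OrePoly σ // DegLT r n} → (Fin n → F) := fun r i => coeff r.1 i
  have hc : Function.Bijective c := by
    constructor
    · intro r s hrs
      refine Subtype.ext (ext_coeff fun k => ?_)
      rcases lt_or_ge k n with h | h
      · exact congrFun hrs ⟨k, h⟩
      · rw [r.2 k h, s.2 k h]
    · intro a
      obtain ⟨r, hr, hra⟩ := exists_degLT_coeff_eq (σ := σ) n
        fun i => if h : i < n then a ⟨i, h⟩ else 0
      refine ⟨⟨r, hr⟩, funext fun i => ?_⟩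
      change coeff r i = a i
      rw [hra i i.2, dif_pos i.2]
  rw [← Nat.card_congr (Equiv.ofBijective e he), Nat.card_congr (Equiv.ofBijective c hc),
    Nat.card_fun, Nat.card_fin]

theorem finite_quotient_span [Finite F] {f : OrePoly σ} (hf : f ≠ 0) :
    Finite (OrePoly σ ⧸ Ideal.span {f}) := by
  obtain ⟨n, hn⟩ := exists_hasDeg hf
  exact Nat.finite_of_card_ne_zero
    (by rw [card_quotient_span hn]; exact pow_ne_zero n Nat.card_pos.ne')

end OrePoly

/-! ### The central subring `F^σ[z]`, annihilators and bounds -/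

namespace OrePoly

variable {F : Type*} [Field F] {σ : F ≃+* F}

theorem orderOf_ringAut_pos [Finite F] (σ : F ≃+* F) : 0 < orderOf (σ : RingAut F) :=
  have : Finite (RingAut F) := Finite.of_injective (fun (τ : F ≃+* F) => (τ : F → F))
    DFunLike.coe_injective
  orderOf_pos (σ : RingAut F)

theorem pow_apply_fixedField (n : ℕ) (a : fixedField σ) : (σ ^ n) (a : F) = a := by
  induction n with
  | zero => rfl
  | succ n ih =>
    rw [pow_succ]
    change (σ ^ n) (σ (a : F)) = a
    rw [show σ (a : F) = a from a.2, ih]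

theorem evalZ_add (p q : Polynomial (fixedField σ)) : evalZ σ (p + q) = evalZ σ p + evalZ σ q :=
  Polynomial.eval₂_add _ _

theorem evalZ_monomial (n : ℕ) (a : fixedField σ) :
    evalZ σ (Polynomial.monomial n a) = monomial σ (orderOf (σ : RingAut F) * n) a := by
  rw [evalZ, Polynomial.eval₂_monomial, ← pow_mul, var_pow_eq_monomial]
  change monomial σ 0 (a : F) * _ = _
  rw [monomial_mul_monomial, map_one, mul_one, zero_add]

theorem coeff_evalZ [Finite F] (p : Polynomial (fixedField σ)) (k : ℕ) :
    coeff (evalZ σ p) k =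
      if orderOf (σ : RingAut F) ∣ k then (p.coeff (k / orderOf (σ : RingAut F)) : F) else 0 := by
  have hμ : 0 < orderOf (σ : RingAut F) := orderOf_ringAut_pos σ
  induction p using Polynomial.induction_on' with
  | add p q hp hq =>
    rw [evalZ_add, coeff_add, hp, hq]
    split_ifs <;> simp
  | monomial n a =>
    rw [evalZ_monomial, coeff_monomial, Polynomial.coeff_monomial]
    by_cases h : orderOf (σ : RingAut F) ∣ k
    · obtain ⟨m, rfl⟩ := h
      rw [if_pos (dvd_mul_right _ _), Nat.mul_div_cancel_left _ hμ]
      by_cases hnm : n = m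
      · simp [hnm]
      · rw [if_neg hnm, if_neg fun h => hnm (Nat.eq_of_mul_eq_mul_left hμ h)]
        rfl
    · rw [if_neg h, if_neg fun h' => h (Dvd.intro n h')]

/-- `X ^ μ` commutes with constants since `σ ^ μ = 1`, and coefficients in `F^σ` commute with `X`.
-/
theorem evalZ_mul_comm (p : Polynomial (fixedField σ)) (f : OrePoly σ) :
    evalZ σ p * f = f * evalZ σ p := by
  induction p using Polynomial.induction_on' with
  | add p q hp hq => rw [evalZ_add, add_mul, mul_add, hp, hq]
  | monomial n a =>
    induction f using induction with
    | zero => simp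
    | monomial_add m b f ih =>
      rw [mul_add, add_mul, ih, evalZ_monomial, monomial_mul_monomial, monomial_mul_monomial,
        pow_apply_fixedField, pow_mul, pow_orderOf_eq_one, one_pow, add_comm m]
      rw [show (1 : F ≃+* F) b = b from rfl, mul_comm b]

/-- The embedding of `F^σ[z]` in `F[X; σ]`, with `z = X ^ μ`. -/
noncomputable def evalZHom (σ : F ≃+* F) : Polynomial (fixedField σ) →+* OrePoly σ :=
  Polynomial.eval₂RingHom' ((const σ).comp (fixedField σ).subtype)
    (var σ ^ orderOf (σ : RingAut F)) fun a => by
      have := evalZ_mul_comm (Polynomial.C a) (var σ ^ orderOf (σ : RingAut F))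
      rwa [evalZ, Polynomial.eval₂_C] at this

theorem evalZHom_apply (p : Polynomial (fixedField σ)) : evalZHom σ p = evalZ σ p := rfl

theorem hasDeg_evalZ [Finite F] {p : Polynomial (fixedField σ)} (hp : p ≠ 0) :
    HasDeg (evalZ σ p) (orderOf (σ : RingAut F) * p.natDegree) := by
  have hμ : 0 < orderOf (σ : RingAut F) := orderOf_ringAut_pos σ
  constructor
  · rw [coeff_evalZ, if_pos (dvd_mul_right _ _), Nat.mul_div_cancel_left _ hμ]
    exact fun h => hp (Polynomial.leadingCoeff_eq_zero.mp (Subtype.ext h))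
  · intro k hk
    rw [coeff_evalZ]
    split_ifs with h
    · obtain ⟨m, rfl⟩ := h
      rw [Nat.mul_div_cancel_left _ hμ, Polynomial.coeff_eq_zero_of_natDegree_lt]
      · rfl
      · exact Nat.lt_of_mul_lt_mul_left hk
    · rfl

theorem evalZ_ne_zero [Finite F] {p : Polynomial (fixedField σ)} (hp : p ≠ 0) :
    evalZ σ p ≠ 0 := (hasDeg_evalZ hp).ne_zero

/-- The commutative remainder `q % p` stays in the left ideal but has too small a degree to be
nonzero there. -/
theorem dvd_of_evalZ_mem_span [Finite F] {p q : Polynomial (fixedField σ)} (hp : p ≠ 0)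
    (h : evalZ σ q ∈ Ideal.span {evalZ σ p}) : p ∣ q := by
  have hmod : evalZ σ (q % p) ∈ Ideal.span {evalZ σ p} := by
    have hq : evalZ σ (q % p) = evalZ σ q - evalZ σ (q / p) * evalZ σ p := by
      simp only [← evalZHom_apply, ← map_mul, ← map_sub]
      rw [EuclideanDomain.mod_eq_sub_mul_div, mul_comm p]
    rw [hq]
    exact sub_mem h (Ideal.mul_mem_left _ _ (Ideal.mem_span_singleton_self _))
  rw [← EuclideanDomain.mod_eq_zero]
  by_contra h0
  have h1 : (q % p).natDegree < p.natDegree :=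
    Polynomial.natDegree_lt_natDegree h0 (EuclideanDomain.mod_lt q hp)
  have h2 := (Nat.mul_lt_mul_left (orderOf_ringAut_pos σ)).mpr h1
  exact evalZ_ne_zero h0
    (eq_zero_of_mem_span (hasDeg_evalZ hp) hmod ((hasDeg_evalZ h0).2.mono h2))

theorem exists_evalZ_eq [Finite F] {f : OrePoly σ} (hfix : ∀ k, σ (coeff f k) = coeff f k)
    (hdvd : ∀ k, coeff f k ≠ 0 → orderOf (σ : RingAut F) ∣ k) : ∃ p, evalZ σ p = f := by
  have hμ : 0 < orderOf (σ : RingAut F) := orderOf_ringAut_pos σ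
  obtain ⟨n, hn⟩ := exists_degLT f
  refine ⟨∑ i ∈ Finset.range n, Polynomial.monomial i
    (⟨coeff f (orderOf (σ : RingAut F) * i), hfix _⟩ : fixedField σ), ext_coeff fun k => ?_⟩
  rw [coeff_evalZ]
  split_ifs with h
  · obtain ⟨m, rfl⟩ := h
    rw [Nat.mul_div_cancel_left _ hμ, Polynomial.finsetSum_coeff]
    simp only [Polynomial.coeff_monomial, Finset.sum_ite_eq', Finset.mem_range]
    split_ifs with hm
    · rfl
    · exact (hn _ (by nlinarith)).symm
  · by_contra h'
    exact h (hdvd k (Ne.symm h'))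

theorem mem_annihilator_quotient_span {f r : OrePoly σ} :
    r ∈ Module.annihilator (OrePoly σ) (OrePoly σ ⧸ Ideal.span {f}) ↔
      ∀ s, r * s ∈ Ideal.span {f} := by
  rw [Module.mem_annihilator]
  constructor
  · intro h s
    exact (Submodule.Quotient.mk_eq_zero _).mp (h (Submodule.Quotient.mk s))
  · intro h m
    obtain ⟨s, rfl⟩ := Submodule.Quotient.mk_surjective _ m
    exact (Submodule.Quotient.mk_eq_zero _).mpr (h s)

theorem annihilator_quotient_le {f : OrePoly σ} :
    Module.annihilator (OrePoly σ) (OrePoly σ ⧸ Ideal.span {f}) ≤ Ideal.span {f} := fun r hr => by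
  simpa using mem_annihilator_quotient_span.mp hr 1

theorem le_annihilator_quotient {f : OrePoly σ} (I : Ideal (OrePoly σ)) [I.IsTwoSided]
    (hI : I ≤ Ideal.span {f}) :
    I ≤ Module.annihilator (OrePoly σ) (OrePoly σ ⧸ Ideal.span {f}) := fun _ hr =>
  mem_annihilator_quotient_span.mpr fun s => hI (I.mul_mem_right s hr)

theorem isBound_evalZ_iff {f : OrePoly σ} {p : Polynomial (fixedField σ)} :
    IsBound f (evalZ σ p) ↔
      Ideal.span {evalZ σ p} = Module.annihilator (OrePoly σ) (OrePoly σ ⧸ Ideal.span {f}) := by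
  have htwo : (Ideal.span {evalZ σ p}).IsTwoSided := ⟨fun {a} b ha => by
    obtain ⟨c, rfl⟩ := Ideal.mem_span_singleton'.mp ha
    rw [mul_assoc, evalZ_mul_comm, ← mul_assoc]
    exact Ideal.mul_mem_left _ _ (Ideal.mem_span_singleton_self _)⟩
  constructor
  · intro h
    exact le_antisymm (le_annihilator_quotient _ h.le)
      (h.greatest _ inferInstance annihilator_quotient_le)
  · intro h
    refine ⟨fun x => ?_, h ▸ annihilator_quotient_le,
      fun I _ hI => h ▸ le_annihilator_quotient I hI⟩
    simp only [Ideal.mem_span_singleton', evalZ_mul_comm, eq_comm]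

/-- `X` acts surjectively on `R/Rf`: modulo `Rf`, any `s` can be stripped of its constant term, and
what remains lies in `RX ⊆ XR`. -/
theorem mem_annihilator_of_mul_var_mem {f r : OrePoly σ} (hf : coeff f 0 ≠ 0)
    (hr : r * var σ ∈ Module.annihilator (OrePoly σ) (OrePoly σ ⧸ Ideal.span {f})) :
    r ∈ Module.annihilator (OrePoly σ) (OrePoly σ ⧸ Ideal.span {f}) := by
  rw [mem_annihilator_quotient_span] at hr ⊢
  intro s
  set c := const σ (coeff s 0 / coeff f 0)
  obtain ⟨g, hg⟩ : ∃ g, s - c * f = g * var σ := exists_eq_mul_var (by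
    rw [coeff_sub, coeff_const_mul, div_mul_cancel₀ _ hf, sub_self])
  obtain ⟨t, ht⟩ := exists_mul_var_eq g
  have hs : r * s = r * c * f + r * var σ * t := by
    rw [mul_assoc, mul_assoc, ← ht, ← hg, ← mul_add, add_sub_cancel]
  rw [hs]
  exact add_mem (Ideal.mul_mem_left _ _ (Ideal.mem_span_singleton_self f)) (hr t)

/-- A two-sided ideal whose elements can be divided by the variable is generated by an element of
`F^σ[z]`. -/
theorem exists_span_evalZ_eq [Finite F] (I : Ideal (OrePoly σ)) [I.IsTwoSided] (hI : I ≠ ⊥)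
    (hvar : ∀ r, r * var σ ∈ I → r ∈ I) : ∃ p, Ideal.span {evalZ σ p} = I := by
  obtain ⟨g, rfl⟩ := exists_eq_span I
  have hg0 : g ≠ 0 := by
    rintro rfl
    exact hI (by simp)
  obtain ⟨n, hn⟩ := exists_hasDeg hg0
  set b := const σ (coeff g n)⁻¹ * g with hb_def
  have hcoeff : ∀ k, coeff b k = (coeff g n)⁻¹ * coeff g k := coeff_const_mul _ g
  have hb : b ∈ Ideal.span {g} := Ideal.mul_mem_left _ _ (Ideal.mem_span_singleton_self g)
  have hbn : coeff b n = 1 := by rw [hcoeff, inv_mul_cancel₀ hn.1]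
  have hbdeg : DegLT b (n + 1) := fun k hk => by rw [hcoeff, hn.2 k hk, mul_zero]
  -- Otherwise cancelling `X` gives a nonzero element of the ideal of smaller degree than its
  -- generator.
  have hg00 : coeff g 0 ≠ 0 := by
    intro h
    obtain ⟨r, hr⟩ := exists_eq_mul_var h
    have hrI := hvar r (hr ▸ Ideal.mem_span_singleton_self g)
    have hr0 : r ≠ 0 := by
      rintro rfl
      exact hg0 (by rw [hr, zero_mul])
    obtain ⟨m, hm⟩ := exists_hasDeg hr0
    have := (hr ▸ hm.mul hasDeg_var).unique hn
    exact hr0 (eq_zero_of_mem_span hn hrI (hm.2.mono (by omega)))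
  have hpow : ∀ k, coeff b k ≠ 0 → ∀ a, (σ ^ k) a = (σ ^ n) a := by
    intro k hk a
    -- The twist `σ ^ n` is chosen to cancel the coefficient of degree `n`, so minimality of the
    -- degree makes this element zero.
    have hx : b * const σ a - const σ ((σ ^ n) a) * b ∈ Ideal.span {g} :=
      sub_mem (Ideal.mul_mem_right _ _ hb) (Ideal.mul_mem_left _ _ hb)
    have hc := coeff_mul_const_sub_const_mul b a ((σ ^ n) a)
    have h0 := eq_zero_of_mem_span hn hx (DegLT.of_succ
      (fun j hj => by rw [hc, hbdeg j hj, zero_mul]) (by rw [hc, sub_self, mul_zero]))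
    have := hc k
    rw [h0, coeff_zero] at this
    exact sub_eq_zero.mp ((mul_eq_zero.mp this.symm).resolve_left hk)
  have hb0 : coeff b 0 ≠ 0 := by
    rw [hcoeff]
    exact mul_ne_zero (inv_ne_zero hn.1) hg00
  -- The nonzero constant term gives `σ ^ n = 1`, so every exponent that occurs is a multiple of
  -- `μ`.
  have hdvd : ∀ k, coeff b k ≠ 0 → orderOf (σ : RingAut F) ∣ k := fun k hk =>
    orderOf_dvd_of_pow_eq_one (RingEquiv.ext fun a =>
      (hpow k hk a).trans (hpow 0 hb0 a).symm)
  have hcomm := coeff_var_mul_sub_mul_var b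
  -- Since `b` is monic, the commutator has degree at most `n`, and its constant term is zero.
  have hzero : var σ * b - b * var σ = 0 := by
    refine eq_zero_of_mem_span_of_coeff_zero hn hg00
      (sub_mem (Ideal.mul_mem_left _ _ hb) (Ideal.mul_mem_right _ _ hb)) (fun k hk => ?_)
      (coeff_var_mul_sub_mul_var_zero b)
    obtain ⟨j, rfl⟩ : ∃ j, k = j + 1 := ⟨k - 1, by omega⟩
    rw [hcomm]
    rcases (Nat.le_of_succ_le_succ hk).eq_or_lt with rfl | h
    · rw [hbn, map_one, sub_self]
    · rw [hbdeg j h, map_zero, sub_self]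
  obtain ⟨p, hp⟩ := exists_evalZ_eq (f := b) (fun k => by
    have := hcomm k
    rw [hzero, coeff_zero] at this
    exact (sub_eq_zero.mp this.symm)) hdvd
  refine ⟨p, hp ▸ le_antisymm ((Ideal.span_singleton_le_iff_mem _).mpr hb)
    ((Ideal.span_singleton_le_iff_mem _).mpr (Ideal.mem_span_singleton'.mpr
      ⟨const σ (coeff g n), ?_⟩))⟩
  rw [hb_def, ← mul_assoc, ← map_mul, mul_inv_cancel₀ hn.1, map_one, one_mul]

/-- The action of `F^σ[z]` on an `F[X; σ]`-module. -/
noncomputable def evalZEnd (σ : F ≃+* F) (M : Type*) [AddCommGroup M] [Module (OrePoly σ) M] :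
    Polynomial (fixedField σ) →+* Module.End (OrePoly σ) M where
  toFun p :=
    { toFun := fun m => evalZHom σ p • m
      map_add' := smul_add _
      map_smul' := fun r m => by
        rw [RingHom.id_apply, smul_smul, smul_smul, evalZHom_apply, evalZ_mul_comm] }
  map_one' := LinearMap.ext fun m => by simp
  map_zero' := LinearMap.ext fun m => by simp
  map_mul' p q := LinearMap.ext fun m => by
    change evalZHom σ (p * q) • m = evalZHom σ p • evalZHom σ q • m
    rw [map_mul, mul_smul]
  map_add' p q := LinearMap.ext fun m => by simp [add_smul]

theorem evalZEnd_apply {M : Type*} [AddCommGroup M] [Module (OrePoly σ) M]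
    (p : Polynomial (fixedField σ)) (m : M) : evalZEnd σ M p m = evalZ σ p • m := rfl

theorem evalZEnd_eq_zero_iff {M : Type*} [AddCommGroup M] [Module (OrePoly σ) M]
    {p : Polynomial (fixedField σ)} :
    evalZEnd σ M p = 0 ↔ evalZ σ p ∈ Module.annihilator (OrePoly σ) M := by
  rw [Module.mem_annihilator, LinearMap.ext_iff]
  rfl

/-- Otherwise the infinite ring `F^σ[z]` would embed in the finite ring `End M`. -/
theorem annihilator_ne_bot [Finite F] (M : Type*) [AddCommGroup M] [Module (OrePoly σ) M]
    [Finite M] : Module.annihilator (OrePoly σ) M ≠ ⊥ := by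
  intro h
  have : Finite (Module.End (OrePoly σ) M) := DFunLike.finite _
  have hinj : Function.Injective (evalZEnd σ M) := by
    rw [injective_iff_map_eq_zero]
    intro p hp
    rw [evalZEnd_eq_zero_iff, h, Submodule.mem_bot] at hp
    by_contra hp0
    exact evalZ_ne_zero hp0 hp
  exact not_finite_iff_infinite.mpr inferInstance
    (Finite.of_injective (α := Polynomial (fixedField σ)) _ hinj)

theorem exists_isBound [Finite F] {f : OrePoly σ} (hf : coeff f 0 ≠ 0) :
    ∃ p, IsBound f (evalZ σ p) := by
  have hf0 : f ≠ 0 := by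
    rintro rfl
    exact hf rfl
  have := finite_quotient_span hf0
  obtain ⟨p, hp⟩ := exists_span_evalZ_eq
    (Module.annihilator (OrePoly σ) (OrePoly σ ⧸ Ideal.span {f}))
    (annihilator_ne_bot _) (fun r => mem_annihilator_of_mul_var_mem hf)
  exact ⟨p, isBound_evalZ_iff.mpr hp⟩

end OrePoly

/-! ### Finite simple modules -/

section SimpleModule

variable {R M : Type*} [Ring R] [AddCommGroup M] [Module R M]

/-- The endomorphisms of a finite simple module commute, by Schur and Wedderburn. -/
theorem Module.End.mul_comm_of_isSimpleModule [Finite M] [IsSimpleModule R M]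
    (a b : Module.End R M) : a * b = b * a := by
  classical
  have : _root_.Finite (Module.End R M) := DFunLike.finite _
  exact (littleWedderburn (Module.End R M)).mul_comm a b

/-- On a finite simple module every endomorphism is the action of a ring element. -/
theorem Module.End.exists_smul_of_isSimpleModule [Finite M] [IsSimpleModule R M]
    (d : Module.End R M) : ∃ r : R, ∀ m : M, d m = r • m := by
  have : Module.Finite (Module.End R M) M := Module.Finite.of_finite
  -- Commutativity makes `d` linear over `End M`, so the density theorem applies to it.
  let f : Module.End (Module.End R M) M :=
    { toFun := d
      map_add' := map_add d
      map_smul' := fun c m => DFunLike.congr_fun (mul_comm_of_isSimpleModule d c) m }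
  obtain ⟨r, hr⟩ := Module.Finite.toModuleEnd_moduleEnd_surjective f
  exact ⟨r, fun m => (DFunLike.congr_fun hr m).symm⟩

/-- A finite simple module and the quotient by its annihilator are powers of its endomorphism
field, with exponents `n` and `n ^ 2`. -/
theorem IsSimpleModule.exists_card_eq_pow [Finite M] [IsSimpleModule R M] :
    ∃ n : ℕ, Nat.card M = Nat.card (Module.End R M) ^ n ∧
      Nat.card (R ⧸ Module.annihilator R M) = Nat.card (Module.End R M) ^ (n ^ 2) := by
  classical
  have hfin : Finite (Module.End R M) := DFunLike.finite _
  let _ : Field (Module.End R M) :=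
    { (inferInstance : DivisionRing (Module.End R M)) with
      mul_comm := Module.End.mul_comm_of_isSimpleModule }
  have : Module.Finite (Module.End R M) M := Module.Finite.of_finite
  refine ⟨Module.finrank (Module.End R M) M, Module.natCard_eq_pow_finrank, ?_⟩
  have hsurj := Module.Finite.toModuleEnd_moduleEnd_surjective (R := R) (M := M)
  have hker : RingHom.ker (Module.toModuleEnd (Module.End R M) (S := R) M) =
      Module.annihilator R M := by
    ext r
    rw [RingHom.mem_ker, Module.mem_annihilator, LinearMap.ext_iff]
    rfl
  rw [← hker, Nat.card_congr (RingHom.quotientKerEquivOfSurjective hsurj).toEquiv,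
    Module.natCard_eq_pow_finrank (K := Module.End R M), sq]
  congr 1
  exact Module.finrank_linearMap (Module.End R M) (Module.End R M) M M

end SimpleModule

/-! ### Irreducibility and the degree of the bound -/

namespace OrePoly

variable {F : Type*} [Field F] {σ : F ≃+* F}

/-- Artin's theorem for the cyclic group generated by `σ`. -/
theorem card_eq_card_fixedField_pow [Finite F] (σ : F ≃+* F) :
    Nat.card F = Nat.card (fixedField σ) ^ orderOf (σ : RingAut F) := by
  classical
  have hfin : Finite (RingAut F) := Finite.of_injective (fun (τ : F ≃+* F) => (τ : F → F))
    DFunLike.coe_injective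
  let G := Subgroup.zpowers (σ : RingAut F)
  have : Fintype G := Fintype.ofFinite G
  have hfix : FixedPoints.subfield G F = fixedField σ := by
    ext a
    constructor
    · intro h
      exact h ⟨σ, Subgroup.mem_zpowers σ⟩
    · rintro h ⟨τ, hτ⟩
      have hle : G ≤ MulAction.stabilizer (RingAut F) a :=
        (Subgroup.zpowers_le (G := RingAut F)).mpr h
      exact hle hτ
  have hcard := Module.natCard_eq_pow_finrank (K := FixedPoints.subfield G F) (V := F)
  rwa [FixedPoints.finrank_eq_card G F, hfix, ← Nat.card_eq_fintype_card, Nat.card_zpowers]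
    at hcard

theorem IsIrred.isSimpleModule {f : OrePoly σ} (hf : IsIrred f) :
    IsSimpleModule (OrePoly σ) (OrePoly σ ⧸ Ideal.span {f}) := by
  have hf0 : f ≠ 0 := by
    rintro rfl
    exact not_lt_bot hf.1
  obtain ⟨n, hn⟩ := exists_hasDeg hf0
  have hn0 : 0 < n := by
    have := hf.1
    rw [hn.degree_eq] at this
    exact_mod_cast this
  rw [isSimpleModule_iff_isCoatom]
  refine ⟨fun htop => ?_, fun J hJ => ?_⟩
  · refine one_ne_zero (eq_zero_of_mem_span hn (htop ▸ Submodule.mem_top) ?_)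
    exact (degLT_monomial 0 1).mono hn0
  · obtain ⟨g, rfl⟩ := exists_eq_span J
    obtain ⟨h, hh⟩ := Ideal.mem_span_singleton'.mp (hJ.le (Ideal.mem_span_singleton_self f))
    rcases hf.2 h g hh.symm with ⟨a, ha⟩ | ⟨a, ha⟩
    · have ha0 : a ≠ 0 := by
        rintro rfl
        exact hf0 (by rw [← hh, ← ha, map_zero, zero_mul])
      refine absurd ((Ideal.span_singleton_le_iff_mem _).mpr
        (Ideal.mem_span_singleton'.mpr ⟨const σ a⁻¹, ?_⟩)) hJ.not_ge
      rw [← hh, ← ha, ← mul_assoc, ← map_mul, inv_mul_cancel₀ ha0, map_one, one_mul]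
    · have ha0 : a ≠ 0 := by
        rintro rfl
        exact hf0 (by rw [← hh, ← ha, map_zero, mul_zero])
      rw [Ideal.eq_top_iff_one]
      refine Ideal.mem_span_singleton'.mpr ⟨const σ a⁻¹, ?_⟩
      rw [← ha, ← map_mul, inv_mul_cancel₀ ha0, map_one]

/-- An endomorphism of a finite simple module is given by an element of `F^σ[z]`. -/
theorem evalZEnd_surjective [Finite F] {M : Type*} [AddCommGroup M] [Module (OrePoly σ) M]
    [Finite M] [IsSimpleModule (OrePoly σ) M] {p : Polynomial (fixedField σ)} (hp : p ≠ 0)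
    (hann : Ideal.span {evalZ σ p} = Module.annihilator (OrePoly σ) M) :
    Function.Surjective (evalZEnd σ M) := by
  intro d
  obtain ⟨r, hr⟩ := Module.End.exists_smul_of_isSimpleModule d
  have hdeg := hasDeg_evalZ hp
  set N := orderOf (σ : RingAut F) * p.natDegree
  obtain ⟨q, s, rfl, hs⟩ := exists_eq_mul_add hdeg r
  have hqp : q * evalZ σ p ∈ Module.annihilator (OrePoly σ) M :=
    hann ▸ Ideal.mul_mem_left _ q (Ideal.mem_span_singleton_self _)
  have hds : ∀ m, d m = s • m := fun m => by
    rw [hr, add_smul, Module.mem_annihilator.mp hqp, zero_add]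
  -- The remainder `s` acts as the `R`-linear map `d`, so it is central modulo the annihilator; the
  -- degree bound turns this into genuine centrality.
  have hcomm : ∀ t, s * t - t * s ∈ Ideal.span {evalZ σ p} := fun t => by
    rw [hann, Module.mem_annihilator]
    intro m
    rw [sub_smul, mul_smul, mul_smul, ← hds, ← hds, map_smul, sub_self]
  have hdvd : ∀ k, coeff s k ≠ 0 → orderOf (σ : RingAut F) ∣ k := by
    refine fun k hk => orderOf_dvd_of_pow_eq_one (RingEquiv.ext fun a => ?_)
    have hc := coeff_mul_const_sub_const_mul s a a
    have h0 := eq_zero_of_mem_span hdeg (hcomm (const σ a))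
      fun j hj => by rw [hc, hs j hj, zero_mul]
    have := hc k
    rw [h0, coeff_zero] at this
    exact sub_eq_zero.mp ((mul_eq_zero.mp this.symm).resolve_left hk)
  have hzero : var σ * s - s * var σ = 0 := by
    refine eq_zero_of_mem_span hdeg (by simpa using neg_mem (hcomm (var σ))) fun j hj => ?_
    rcases j with _ | k
    · exact coeff_var_mul_sub_mul_var_zero s
    rw [coeff_var_mul_sub_mul_var]
    by_cases hk : coeff s k = 0
    · rw [hk, map_zero, sub_self]
    -- The commutator with `X` may have degree exactly `N`. In that case `μ` divides both `N - 1`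
    -- and `N`, so `σ = 1` and the coefficient still vanishes.
    · have hkN : k + 1 = N := by
        by_contra h
        exact hk (hs k (by omega))
      have h1 : orderOf (σ : RingAut F) = 1 := Nat.dvd_one.mp
        ((Nat.dvd_add_right (hdvd k hk)).mp (hkN ▸ dvd_mul_right _ _))
      rw [show σ = 1 from orderOf_eq_one_iff.mp h1]
      exact sub_self _
  obtain ⟨u, hu⟩ := exists_evalZ_eq (fun k => by
    have := coeff_var_mul_sub_mul_var s k
    rw [hzero, coeff_zero] at this
    exact sub_eq_zero.mp this.symm) hdvd
  exact ⟨u, LinearMap.ext fun m => by rw [evalZEnd_apply, hu, hds]⟩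

theorem IsIrred.irreducible_bound [Finite F] {f : OrePoly σ} {n : ℕ} (hf : IsIrred f)
    (hn : HasDeg f n) {p : Polynomial (fixedField σ)} (hp : IsBound f (evalZ σ p)) :
    Irreducible p ∧ p.natDegree = n := by
  classical
  have hsimple := hf.isSimpleModule
  have hfinite := finite_quotient_span hn.ne_zero
  have hcardM := card_quotient_span hn
  rw [isBound_evalZ_iff] at hp
  have hbot := annihilator_ne_bot (σ := σ) (OrePoly σ ⧸ Ideal.span {f})
  set M := OrePoly σ ⧸ Ideal.span {f}
  have hp0 : p ≠ 0 := by
    rintro rfl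
    refine hbot (hp ▸ ?_)
    rw [← evalZHom_apply, map_zero, Ideal.span_singleton_eq_bot]
  have hker : RingHom.ker (evalZEnd σ M) = Ideal.span {p} := by
    ext q
    rw [RingHom.mem_ker, evalZEnd_eq_zero_iff, ← hp, Ideal.mem_span_singleton]
    refine ⟨dvd_of_evalZ_mem_span hp0, ?_⟩
    rintro ⟨c, rfl⟩
    rw [mul_comm, ← evalZHom_apply (c * p), map_mul]
    exact Ideal.mul_mem_left _ _ (Ideal.mem_span_singleton_self _)
  have hirr : Irreducible p := by
    -- By Schur's lemma `End M` has no zero divisors.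
    have hprime := RingHom.ker_isPrime (evalZEnd σ M)
    rw [hker, Ideal.span_singleton_prime hp0] at hprime
    exact hprime.irreducible
  refine ⟨hirr, ?_⟩
  have hpos := hirr.natDegree_pos
  have hcardD : Nat.card (Module.End (OrePoly σ) M) =
      Nat.card (fixedField σ) ^ p.natDegree := by
    rw [← Nat.card_congr (RingHom.quotientKerEquivOfSurjective
      (evalZEnd_surjective (M := M) hp0 hp)).toEquiv, hker, ← finrank_quotient_span_eq_natDegree]
    have : Module.Finite (fixedField σ) (Polynomial (fixedField σ) ⧸ Ideal.span {p}) :=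
      (AdjoinRoot.powerBasis hp0).finite
    exact Module.natCard_eq_pow_finrank
  obtain ⟨e, he1, he2⟩ := IsSimpleModule.exists_card_eq_pow (R := OrePoly σ) (M := M)
  have hk : 2 ≤ Nat.card (fixedField σ) := Finite.one_lt_card
  rw [← hp, card_quotient_span (hasDeg_evalZ hp0), hcardD, card_eq_card_fixedField_pow σ,
    ← pow_mul, ← pow_mul] at he2
  rw [hcardM, hcardD, card_eq_card_fixedField_pow σ, ← pow_mul, ← pow_mul] at he1
  replace he1 := Nat.pow_right_injective hk he1
  replace he2 := Nat.pow_right_injective hk he2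
  have hμ := orderOf_ringAut_pos σ
  -- With `d = deg_z p`, the exponents of `|F^σ|` read `μ * n = d * e` and `μ * (μ * d) = d * e ^
  -- 2`.
  have he : orderOf (σ : RingAut F) = e := by
    refine Nat.pow_left_injective two_ne_zero (Nat.eq_of_mul_eq_mul_left hpos ?_)
    dsimp only
    rw [← he2]
    ring
  rw [← he, mul_comm] at he1
  exact (Nat.eq_of_mul_eq_mul_right hμ he1).symm

/-- A right factor of least positive degree is irreducible. -/
theorem exists_irred_right_factor {f : OrePoly σ} {n : ℕ} (hf : HasDeg f n) (hn : 0 < n) :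
    ∃ g h, f = g * h ∧ IsIrred h := by
  classical
  have hex : ∃ m, 0 < m ∧ ∃ g h, f = g * h ∧ HasDeg h m := ⟨n, hn, 1, f, (one_mul f).symm, hf⟩
  obtain ⟨hm, g, h, rfl, hh⟩ := Nat.find_spec hex
  refine ⟨g, h, rfl, ?_, ?_⟩
  · rw [hh.degree_eq]
    exact_mod_cast hm
  · rintro u v rfl
    have huv := hh.ne_zero
    obtain ⟨i, hi⟩ := exists_hasDeg (left_ne_zero_of_mul huv)
    obtain ⟨j, hj⟩ := exists_hasDeg (right_ne_zero_of_mul huv)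
    have hij := (hi.mul hj).unique hh
    rcases Nat.eq_zero_or_pos j with rfl | hj0
    · exact Or.inr (mem_range_const.mpr hj.2)
    · have := Nat.find_min' hex ⟨hj0, g * u, v, (mul_assoc g u v).symm, hj⟩
      obtain rfl : i = 0 := by omega
      exact Or.inl (mem_range_const.mpr hi.2)

theorem IsIrred.const_mul {h : OrePoly σ} (hh : IsIrred h) {a : F} (ha : a ≠ 0) :
    IsIrred (const σ a * h) := by
  have hh0 : h ≠ 0 := by
    rintro rfl
    exact not_lt_bot hh.1
  obtain ⟨n, hn⟩ := exists_hasDeg hh0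
  refine ⟨?_, fun u v huv => ?_⟩
  · rw [((hasDeg_const ha).mul hn).degree_eq, zero_add, ← hn.degree_eq]
    exact hh.1
  · have key : h = const σ a⁻¹ * u * v := by
      rw [mul_assoc, ← huv, ← mul_assoc, ← map_mul, inv_mul_cancel₀ ha, map_one, one_mul]
    refine (hh.2 _ _ key).imp_left fun hu => ?_
    have := mul_mem (⟨a, rfl⟩ : const σ a ∈ (const σ).range) hu
    rwa [← mul_assoc, ← map_mul, mul_inv_cancel₀ ha, map_one, one_mul] at this

theorem isIrred_of_irreducible_bound [Finite F] {f : OrePoly σ} {n : ℕ} (hn : HasDeg f n)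
    (hf : coeff f 0 ≠ 0) {p : Polynomial (fixedField σ)} (hp : IsBound f (evalZ σ p))
    (hirr : Irreducible p) (hdeg : p.natDegree = n) : IsIrred f := by
  obtain ⟨g, h, rfl, hh⟩ := exists_irred_right_factor hn (hdeg ▸ hirr.natDegree_pos)
  rw [coeff_mul_zero] at hf
  obtain ⟨q, hq⟩ := exists_isBound (right_ne_zero_of_mul hf)
  obtain ⟨i, hi⟩ := exists_hasDeg (left_ne_zero_of_mul hn.ne_zero)
  obtain ⟨j, hj⟩ := exists_hasDeg (right_ne_zero_of_mul hn.ne_zero)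
  obtain ⟨hqirr, hqdeg⟩ := hh.irreducible_bound hj hq
  -- `Rf ⊆ Rh`, so the central element `p(z)` of `Rf` annihilates `R/Rh`.
  have hmem : evalZ σ p ∈ Ideal.span {evalZ σ q} := by
    rw [isBound_evalZ_iff.mp hq, mem_annihilator_quotient_span]
    intro s
    rw [evalZ_mul_comm]
    refine Ideal.mul_mem_left _ s ?_
    refine ((Ideal.span_singleton_le_iff_mem _).mpr ?_) (hp.le (Ideal.mem_span_singleton_self _))
    exact Ideal.mul_mem_left _ g (Ideal.mem_span_singleton_self h)
  have hassoc : Associated q p :=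
    hqirr.associated_of_dvd hirr (dvd_of_evalZ_mem_span hqirr.ne_zero hmem)
  have hqp := Polynomial.natDegree_eq_of_degree_eq
    (Polynomial.degree_eq_degree_of_associated hassoc)
  have hij := (hi.mul hj).unique hn
  obtain rfl : i = 0 := by omega
  obtain ⟨a, rfl⟩ := mem_range_const.mpr hi.2
  refine hh.const_mul ?_
  rintro rfl
  exact hi.ne_zero (map_zero _)

end OrePoly

theorem proposition5p2 {F : Type*} [Field F] [Finite F] (σ : F ≃+* F) (f : OrePoly σ)
    (hf : IsRightGCD f (OrePoly.var σ) 1) :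
    (∃ p : Polynomial (OrePoly.fixedField σ), IsBound f (OrePoly.evalZ σ p)) ∧
    ∀ p : Polynomial (OrePoly.fixedField σ), IsBound f (OrePoly.evalZ σ p) →
      (OrePoly.IsIrred f ↔
        Irreducible p ∧
          OrePoly.degree (OrePoly.evalZ σ p) =
            (orderOf (σ : RingAut F) : WithBot ℕ) * OrePoly.degree f) := by
  have hf0 := OrePoly.coeff_zero_ne_zero_of_isRightGCD hf
  refine ⟨OrePoly.exists_isBound hf0, fun p hp => ?_⟩
  obtain ⟨n, hn⟩ := OrePoly.exists_hasDeg (f := f) (by rintro rfl; exact hf0 rfl)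
  constructor
  · intro h
    obtain ⟨hirr, hdeg⟩ := h.irreducible_bound hn hp
    refine ⟨hirr, ?_⟩
    rw [(OrePoly.hasDeg_evalZ hirr.ne_zero).degree_eq, hn.degree_eq, hdeg]
    rfl
  · rintro ⟨hirr, hdeg⟩
    refine OrePoly.isIrred_of_irreducible_bound hn hf0 hp hirr ?_
    rw [(OrePoly.hasDeg_evalZ hirr.ne_zero).degree_eq, hn.degree_eq] at hdeg
    exact Nat.eq_of_mul_eq_mul_left (OrePoly.orderOf_ringAut_pos σ) (by exact_mod_cast hdeg)
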